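/- Consider the lattice $\mathbb Z^2$ with nearest-neighbour edges and let $G$ be any probability measure on $[0,\infty)$ (no moment assumption is made). Every vertical edge $e$ has the deterministic weight $\tau_e=1$; the weights $\tau_e$ of the horizontal edges are independent random variables with law $G$. For a finite nearest-neighbour path $p$ let $T(p)=\sum_{e\in p}\tau_e$, and for $a,b\in\mathbb Z^2$ let $T(a,b)=\inf_p T(p)$, where the infimum is over all finite paths from $a$ to $b$ (paths need not be directed). Then there exists a deterministic convex function $\Lambda:[0,\infty)\to[0,\infty)$, depending only on $G$, such that for every $v\in[0,\infty)$ the passage times $T((0,0),(n,\lceil vn\rceil))$, $n\ge 0$, are integrable and $$\lim_{n\to\infty}\frac1n\,T\big((0,0),(n,\lceil vn\rceil)\big)=\Lambda(v)$$ almost surely and in $L^1$. -/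

import Mathlib

open MeasureTheory ProbabilityTheory Filter Topology
open scoped NNReal ENNReal

namespace SemiFPP

/-- The square lattice `ℤ²` as a graph: nearest neighbours are joined by an edge. -/
noncomputable def lattice : SimpleGraph (ℤ × ℤ) :=
  (SimpleGraph.hasse ℤ) □ (SimpleGraph.hasse ℤ)

/-- Two points of `ℤ²` are adjacent iff their `ℓ¹`-distance is one. -/
theorem lattice_adj (a b : ℤ × ℤ) :
    lattice.Adj a b ↔ |a.1 - b.1| + |a.2 - b.2| = 1 := by
  simp only [lattice, SimpleGraph.boxProd_adj, SimpleGraph.hasse_adj, Order.covBy_iff_add_one_eq]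
  obtain ⟨x, y⟩ := a
  obtain ⟨z, w⟩ := b
  rcases abs_cases (x - z) with h | h <;> rcases abs_cases (y - w) with h2 | h2 <;>
    simp only [h, h2] <;> omega

/-- Any two points of `ℤ²` are joined by a path, so that the infimum in `passageTime` below is
over a non-empty set. -/
theorem lattice_preconnected : lattice.Preconnected :=
  (SimpleGraph.hasse_preconnected_of_succ ℤ).boxProd (SimpleGraph.hasse_preconnected_of_succ ℤ)

/-- The weight of an edge of `ℤ²`. Vertical edges have weight `1`. A horizontal edge
has the weight that `t` assigns to its left endpoint: `t (x, y)` is the weight of the edge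
between `(x, y)` and `(x + 1, y)`. (Only used on edges of `lattice`; on a horizontal edge both
endpoints have the same second coordinate.) -/
noncomputable def edgeWeight (t : ℤ × ℤ → ℝ≥0) : Sym2 (ℤ × ℤ) → ℝ :=
  Sym2.lift ⟨fun a b => if a.1 = b.1 then 1 else (t (min a.1 b.1, min a.2 b.2) : ℝ), by
    intro a b
    simp only [min_comm, eq_comm]⟩

/-- The passage time of a finite path: the sum of the weights of the edges that lie in it. -/
noncomputable def pathTime (t : ℤ × ℤ → ℝ≥0) {a b : ℤ × ℤ} (p : lattice.Walk a b) : ℝ :=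
  ∑ e ∈ p.edges.toFinset, edgeWeight t e

/-- The passage time between two points: the infimum of the passage times of all paths
from the first to the second. Every path has nonnegative passage time. -/
noncomputable def passageTime (t : ℤ × ℤ → ℝ≥0) (a b : ℤ × ℤ) : ℝ :=
  ⨅ p : lattice.Walk a b, pathTime t p

end SemiFPP

namespace SemiFPP

/-! ### Reduction to directed paths -/

/-! All vertical edges cost the same, so vertical displacement costs the same in every column, and a
step to the left only undoes progress. Undirected passage times from the origin thus equal
`directedTime` (`passageTime_eq_directedTime`), which depends on the columns `0, …, n - 1` alone.
Hence the two terms of the subadditive bound `directedTime_add_le` are independent.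

No moment of `G` is needed: a path may climb until it meets a cheap edge, and the climb has
geometric tails, so passage times are square integrable.

Independence replaces the ergodic theorem. Along `N * 2 ^ j` the normalized variances are summable
(`summable_sub_sq_of_halving`), which gives almost sure convergence. The gaps are filled by
monotonicity of `directedTime t n ⌈v * n⌉ + ⌈v * n⌉`. Fekete's lemma identifies the limit, Scheffé's
lemma gives `L¹`, and convexity comes from splitting the strip of columns into two strips with
different slopes. -/

/-- The minimal passage time from the origin to `(n, m)` over paths that never step to the left,
computed by recursion over the last horizontal step. -/
noncomputable def directedTime (t : ℤ × ℤ → ℝ≥0) : ℕ → ℤ → ℝ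
  | 0, m => |(m : ℝ)|
  | n + 1, m => ⨅ y : ℤ, (directedTime t n y + t (n, y) + |(m : ℝ) - y|)

theorem directedTime_nonneg (t : ℤ × ℤ → ℝ≥0) (n : ℕ) (m : ℤ) : 0 ≤ directedTime t n m := by
  induction n generalizing m with
  | zero => exact abs_nonneg _
  | succ n ih =>
    exact Real.iInf_nonneg fun y => add_nonneg (add_nonneg (ih y) (NNReal.coe_nonneg _))
      (abs_nonneg _)

theorem directedTime_succ_le (t : ℤ × ℤ → ℝ≥0) (n : ℕ) (m y : ℤ) :
    directedTime t (n + 1) m ≤ directedTime t n y + t (n, y) + |(m : ℝ) - y| :=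
  ciInf_le (f := fun y : ℤ => directedTime t n y + t (n, y) + |(m : ℝ) - y|)
    ⟨0, by
      rintro _ ⟨y, rfl⟩
      exact add_nonneg (add_nonneg (directedTime_nonneg t n y) (NNReal.coe_nonneg _))
        (abs_nonneg _)⟩ y

theorem le_directedTime_succ {t : ℤ × ℤ → ℝ≥0} {n : ℕ} {m : ℤ} {c : ℝ}
    (h : ∀ y : ℤ, c ≤ directedTime t n y + t (n, y) + |(m : ℝ) - y|) :
    c ≤ directedTime t (n + 1) m :=
  le_ciInf h

theorem directedTime_le_add_abs (t : ℤ × ℤ → ℝ≥0) (n : ℕ) (m k : ℤ) :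
    directedTime t n m ≤ directedTime t n k + |(m : ℝ) - k| := by
  cases n with
  | zero =>
    have := abs_add_le (k : ℝ) (m - k)
    simpa [directedTime] using this
  | succ n =>
    rw [← sub_le_iff_le_add]
    refine le_directedTime_succ fun y => ?_
    have h1 := directedTime_succ_le t n m y
    have h2 := abs_sub_le (m : ℝ) k y
    linarith

/-- The vertical stretch made after the last horizontal step could be made before it at the same
cost, and the step itself is then dropped. This is where equality of the vertical weights enters. -/
theorem directedTime_le_succ (t : ℤ × ℤ → ℝ≥0) (n : ℕ) (m : ℤ) :
    directedTime t n m ≤ directedTime t (n + 1) m :=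
  le_directedTime_succ fun y => by
    have h1 := directedTime_le_add_abs t n m y
    have h2 := NNReal.coe_nonneg (t (n, y))
    linarith

theorem directedTime_mono (t : ℤ × ℤ → ℝ≥0) (m : ℤ) : Monotone fun n => directedTime t n m :=
  monotone_nat_of_le_succ fun n => directedTime_le_succ t n m

/-! ### Comparison of lattice walks with the directed recursion. -/

theorem edgeWeight_mk_vertical (t : ℤ × ℤ → ℝ≥0) (x y z : ℤ) :
    edgeWeight t s((x, y), (x, z)) = 1 := by
  simp [edgeWeight]

theorem edgeWeight_mk_horizontal (t : ℤ × ℤ → ℝ≥0) (x y : ℤ) :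
    edgeWeight t s((x, y), (x + 1, y)) = t (x, y) := by
  simp [edgeWeight]

theorem edgeWeight_nonneg (t : ℤ × ℤ → ℝ≥0) (e : Sym2 (ℤ × ℤ)) : 0 ≤ edgeWeight t e := by
  induction e with
  | h a b =>
    simp only [edgeWeight, Sym2.lift_mk]
    split_ifs
    · exact zero_le_one
    · exact NNReal.coe_nonneg _

theorem pathTime_nonneg (t : ℤ × ℤ → ℝ≥0) {a b : ℤ × ℤ} (p : lattice.Walk a b) :
    0 ≤ pathTime t p :=
  Finset.sum_nonneg fun e _ => edgeWeight_nonneg t e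

theorem bddBelow_pathTime (t : ℤ × ℤ → ℝ≥0) (a b : ℤ × ℤ) :
    BddBelow (Set.range fun p : lattice.Walk a b => pathTime t p) :=
  ⟨0, by rintro _ ⟨p, rfl⟩; exact pathTime_nonneg t p⟩

theorem passageTime_le_pathTime (t : ℤ × ℤ → ℝ≥0) {a b : ℤ × ℤ} (p : lattice.Walk a b) :
    passageTime t a b ≤ pathTime t p :=
  ciInf_le (bddBelow_pathTime t a b) p

theorem pathTime_append_le (t : ℤ × ℤ → ℝ≥0) {a b c : ℤ × ℤ} (p : lattice.Walk a b)
    (q : lattice.Walk b c) : pathTime t (p.append q) ≤ pathTime t p + pathTime t q := by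
  classical
  unfold pathTime
  rw [SimpleGraph.Walk.edges_append, List.toFinset_append, ← Finset.sum_union_inter]
  exact le_add_of_nonneg_right (Finset.sum_nonneg fun e _ => edgeWeight_nonneg t e)

theorem passageTime_triangle (t : ℤ × ℤ → ℝ≥0) (a b c : ℤ × ℤ) :
    passageTime t a c ≤ passageTime t a b + passageTime t b c := by
  have : Nonempty (lattice.Walk a b) := lattice_preconnected a b
  have : Nonempty (lattice.Walk b c) := lattice_preconnected b c
  rw [passageTime.eq_def t a b, passageTime.eq_def t b c]
  exact le_ciInf_add_ciInf fun p q =>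
    (passageTime_le_pathTime t (p.append q)).trans (pathTime_append_le t p q)

theorem passageTime_le_edgeWeight (t : ℤ × ℤ → ℝ≥0) {a b : ℤ × ℤ} (h : lattice.Adj a b) :
    passageTime t a b ≤ edgeWeight t s(a, b) :=
  (passageTime_le_pathTime t h.toWalk).trans_eq (by simp [pathTime])

theorem passageTime_self (t : ℤ × ℤ → ℝ≥0) (a : ℤ × ℤ) : passageTime t a a ≤ 0 :=
  (passageTime_le_pathTime t SimpleGraph.Walk.nil).trans_eq (by simp [pathTime])

theorem passageTime_vertical_le (t : ℤ × ℤ → ℝ≥0) (x y z : ℤ) :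
    passageTime t (x, y) (x, z) ≤ |(z : ℝ) - y| := by
  have up (y : ℤ) (k : ℕ) : passageTime t (x, y) (x, y + k) ≤ k ∧
      passageTime t (x, y) (x, y - k) ≤ k := by
    induction k with
    | zero => simpa using passageTime_self t (x, y)
    | succ k ih =>
      have h1 := passageTime_le_edgeWeight t
        (show lattice.Adj (x, y + (k : ℤ)) (x, y + ((k + 1 : ℕ) : ℤ)) by simp [lattice_adj])
      have h2 := passageTime_le_edgeWeight t
        (show lattice.Adj (x, y - (k : ℤ)) (x, y - ((k + 1 : ℕ) : ℤ)) by simp [lattice_adj])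
      rw [edgeWeight_mk_vertical] at h1 h2
      push_cast at h1 h2 ⊢
      exact ⟨(passageTime_triangle t _ _ _).trans (add_le_add ih.1 h1),
        (passageTime_triangle t _ _ _).trans (add_le_add ih.2 h2)⟩
  obtain ⟨k, hk | hk⟩ := Int.eq_nat_or_neg (z - y)
  · obtain rfl : z = y + k := by omega
    simpa using (up y k).1
  · obtain rfl : z = y - k := by omega
    simpa using (up y k).2

theorem passageTime_le_directedTime (t : ℤ × ℤ → ℝ≥0) (n : ℕ) (m : ℤ) :
    passageTime t (0, 0) (n, m) ≤ directedTime t n m := by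
  induction n generalizing m with
  | zero => simpa [directedTime] using passageTime_vertical_le t 0 0 m
  | succ n ih =>
    refine le_directedTime_succ fun y => ?_
    have h1 := passageTime_le_edgeWeight t
      (show lattice.Adj ((n : ℤ), y) ((n : ℤ) + 1, y) by simp [lattice_adj])
    rw [edgeWeight_mk_horizontal] at h1
    have h2 := passageTime_triangle t (0, 0) ((n : ℤ), y) ((n : ℤ) + 1, y)
    have h3 := passageTime_triangle t (0, 0) ((n : ℤ) + 1, y) ((n : ℤ) + 1, m)
    have h4 := passageTime_vertical_le t ((n : ℤ) + 1) y m
    have h5 := ih y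
    push_cast
    linarith

/-- Makes `directedTime` a potential that grows along an edge by at most its weight. `Int.toNat`
collapses all columns left of the origin onto column `0`; steps to the left are free by
`directedTime_mono`. -/
theorem directedTime_le_directedTime_add_edgeWeight (t : ℤ × ℤ → ℝ≥0) {a b : ℤ × ℤ}
    (h : lattice.Adj a b) :
    directedTime t b.1.toNat b.2 ≤ directedTime t a.1.toNat a.2 + edgeWeight t s(a, b) := by
  obtain ⟨x, y⟩ := a
  obtain ⟨z, w⟩ := b
  have hcases : (x = z ∧ |w - y| = 1) ∨ (z = x + 1 ∧ w = y) ∨ (x = z + 1 ∧ w = y) := by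
    rw [lattice_adj] at h
    simp only at h
    rcases abs_cases (x - z) with h1 | h1 <;> rcases abs_cases (y - w) with h2 | h2 <;>
      rcases abs_cases (w - y) with h3 | h3 <;> omega
  rcases hcases with ⟨rfl, hw⟩ | ⟨rfl, rfl⟩ | ⟨rfl, rfl⟩
  · rw [edgeWeight_mk_vertical]
    have h1 := directedTime_le_add_abs t x.toNat w y
    have h2 : |(w : ℝ) - y| = 1 := by exact_mod_cast hw
    simpa [h2] using h1
  · rw [edgeWeight_mk_horizontal]
    rcases lt_or_ge x 0 with hx | hx
    · have h1 : (x + 1).toNat = 0 := by omega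
      have h2 : x.toNat = 0 := by omega
      simp [h1, h2]
    · lift x to ℕ using hx
      simpa using directedTime_succ_le t x w w
  · refine le_add_of_le_of_nonneg ?_ (edgeWeight_nonneg t _)
    exact directedTime_mono t _ (Int.toNat_le_toNat (by simp))

theorem directedTime_le_sum_edges (t : ℤ × ℤ → ℝ≥0) {a b : ℤ × ℤ} (p : lattice.Walk a b) :
    directedTime t b.1.toNat b.2 ≤
      directedTime t a.1.toNat a.2 + (p.edges.map (edgeWeight t)).sum := by
  induction p with
  | nil => simp
  | cons h p ih =>
    have := directedTime_le_directedTime_add_edgeWeight t h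
    simp only [SimpleGraph.Walk.edges_cons, List.map_cons, List.sum_cons]
    linarith

/-- `pathTime` counts each edge once, while the potential bound counts with multiplicity. Loop
erasure reconciles them, since a path repeats no edge. -/
theorem sum_edges_bypass_le_pathTime (t : ℤ × ℤ → ℝ≥0) {a b : ℤ × ℤ} (p : lattice.Walk a b) :
    (p.bypass.edges.map (edgeWeight t)).sum ≤ pathTime t p := by
  classical
  rw [← List.sum_toFinset _ p.bypass_isPath.isTrail.edges_nodup]
  exact Finset.sum_le_sum_of_subset_of_nonneg
    (fun e he => List.mem_toFinset.2 (p.edges_bypass_subset_edges (List.mem_toFinset.1 he)))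
    fun e _ _ => edgeWeight_nonneg t e

/-- Since vertical edges all have the same weight, there is an optimal path that never steps to
the left. -/
theorem passageTime_eq_directedTime (t : ℤ × ℤ → ℝ≥0) (n : ℕ) (m : ℤ) :
    passageTime t (0, 0) (n, m) = directedTime t n m := by
  refine le_antisymm (passageTime_le_directedTime t n m) ?_
  have : Nonempty (lattice.Walk (0, 0) ((n : ℤ), m)) := lattice_preconnected _ _
  refine le_ciInf fun p => ?_
  have h := (directedTime_le_sum_edges t p.bypass).trans
    (add_le_add_right (sum_edges_bypass_le_pathTime t p) _)
  simpa [directedTime] using h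

/-! ### Subadditivity -/

/-- The environment seen from the vertex `a`. -/
def shift (a : ℤ × ℤ) (t : ℤ × ℤ → ℝ≥0) : ℤ × ℤ → ℝ≥0 := fun e => t (a + e)

theorem directedTime_add_le (t : ℤ × ℤ → ℝ≥0) (n k : ℕ) (m l : ℤ) :
    directedTime t (n + k) (m + l) ≤ directedTime t n m + directedTime (shift (n, m) t) k l := by
  induction k generalizing l with
  | zero => simpa [directedTime] using directedTime_le_add_abs t n (m + l) m
  | succ k ih =>
    rw [← sub_le_iff_le_add']
    refine le_directedTime_succ fun y => ?_
    have h1 := directedTime_succ_le t (n + k) (m + l) (m + y)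
    have h2 := ih y
    have h3 : shift (n, m) t (k, y) = t ((n + k : ℕ), m + y) := by simp [shift]
    have h4 : ((m + l : ℤ) : ℝ) - ((m + y : ℤ) : ℝ) = l - y := by push_cast; ring
    rw [h4] at h1
    rw [h3, ← add_assoc]
    linarith

/-! ### Measurability, stationarity, independence -/

/-- The σ-algebra on `α` is left arbitrary so that independence can use the one generated by a strip
of columns. -/
theorem measurable_directedTime_of_columns {α : Type*} {mα : MeasurableSpace α}
    {f : α → ℤ × ℤ → ℝ≥0} (n : ℕ) (hf : ∀ e : ℤ × ℤ, 0 ≤ e.1 → e.1 < n → Measurable fun a => f a e)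
    (m : ℤ) : Measurable fun a => directedTime (f a) n m := by
  induction n generalizing m with
  | zero => exact measurable_const
  | succ n ih =>
    refine Measurable.iInf fun y => ((ih (fun e h0 he => hf e h0 ?_) y).add ?_).add_const _
    · push_cast; omega
    · exact (hf ((n : ℤ), y) (by simp) (by simp)).coe_nnreal_real

theorem measurable_directedTime (n : ℕ) (m : ℤ) :
    Measurable fun t : ℤ × ℤ → ℝ≥0 => directedTime t n m :=
  measurable_directedTime_of_columns n (fun e _ _ => measurable_pi_apply e) m

theorem measurable_shift (a : ℤ × ℤ) : Measurable (shift a) :=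
  measurable_pi_lambda _ fun e => measurable_pi_apply (a + e)

/-- The law of the horizontal weights: they are independent with law `G`. -/
noncomputable def envLaw (G : Measure ℝ≥0) : Measure (ℤ × ℤ → ℝ≥0) :=
  Measure.infinitePi fun _ => G

variable (G : Measure ℝ≥0) [IsProbabilityMeasure G]

instance : IsProbabilityMeasure (envLaw G) := by
  unfold envLaw; infer_instance

theorem measurePreserving_shift (a : ℤ × ℤ) :
    MeasurePreserving (shift a) (envLaw G) (envLaw G) where
  measurable := measurable_shift a
  map_eq := Measure.map_infinitePi_infinitePi_of_inj (P := fun _ : ℤ × ℤ => G)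
    (add_right_injective a)

theorem indepFun_directedTime_shift (n k : ℕ) (m l : ℤ) :
    IndepFun (fun t => directedTime t n m) (fun t => directedTime (shift (n, m) t) k l)
      (envLaw G) := by
  have hind : iIndepFun (fun (e : ℤ × ℤ) (t : ℤ × ℤ → ℝ≥0) => t e) (envLaw G) :=
    iIndepFun_infinitePi (P := fun _ : ℤ × ℤ => G) (X := fun _ x => x) fun _ => measurable_id
  have h := indep_iSup_of_disjoint (m := fun e : ℤ × ℤ =>
      MeasurableSpace.comap (fun t : ℤ × ℤ → ℝ≥0 => t e) inferInstance)
    (fun e => (measurable_pi_apply e).comap_le) ((iIndepFun_iff_iIndep _ _ _).1 hind)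
    (S := {e | e.1 < n}) (T := {e | (n : ℤ) ≤ e.1})
    (Set.disjoint_left.2 fun e (h1 : e.1 < n) (h2 : (n : ℤ) ≤ e.1) => h2.not_gt h1)
  have hsup (S : Set (ℤ × ℤ)) (e : ℤ × ℤ) (he : e ∈ S) :
      Measurable[⨆ i ∈ S, MeasurableSpace.comap (fun t : ℤ × ℤ → ℝ≥0 => t i) inferInstance]
        (fun t : ℤ × ℤ → ℝ≥0 => t e) :=
    measurable_iff_comap_le.2 (le_biSup (fun i : ℤ × ℤ =>
      MeasurableSpace.comap (fun t : ℤ × ℤ → ℝ≥0 => t i) inferInstance) he)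
  refine indep_of_indep_of_le_left (indep_of_indep_of_le_right h ?_) ?_
  · exact measurable_iff_comap_le.1 (@measurable_directedTime_of_columns _
      (⨆ i ∈ {e : ℤ × ℤ | (n : ℤ) ≤ e.1}, _) (shift (n, m)) k
      (fun e h0 _ => hsup _ _ (show (n : ℤ) ≤ n + e.1 by omega)) l)
  · exact measurable_iff_comap_le.1 (@measurable_directedTime_of_columns _
      (⨆ i ∈ {e : ℤ × ℤ | e.1 < n}, _) id n (fun e _ he => hsup _ e he) m)

/-! ### Square integrability -/

theorem exists_measure_Ioi_lt_one : ∃ M : ℝ≥0, G (Set.Ioi M) < 1 := by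
  by_contra! h
  have h1 : Tendsto (fun n : ℕ => G (Set.Ioi (n : ℝ≥0))) atTop (𝓝 (G (⋂ n : ℕ, Set.Ioi (n : ℝ≥0)))) :=
    tendsto_measure_iInter_atTop (fun n => measurableSet_Ioi.nullMeasurableSet)
      (fun i j hij => Set.Ioi_subset_Ioi (by exact_mod_cast hij)) ⟨0, measure_ne_top _ _⟩
  have h2 : (⋂ n : ℕ, Set.Ioi (n : ℝ≥0)) = ∅ := by
    refine Set.eq_empty_of_forall_notMem fun x hx => ?_
    obtain ⟨n, hn⟩ := exists_nat_ge x
    exact absurd (Set.mem_iInter.1 hx n) (not_lt.2 hn)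
  rw [h2, measure_empty] at h1
  exact absurd (le_of_tendsto_of_tendsto' tendsto_const_nhds h1 fun n => h n) (by simp)

theorem measure_forall_lt_column (M : ℝ≥0) (k : ℕ) :
    envLaw G {t | ∀ i < k, M < t (0, (i : ℤ))} = G (Set.Ioi M) ^ k := by
  have hinj : Function.Injective fun i : ℕ => ((0 : ℤ), (i : ℤ)) := fun i j h => by simpa using h
  have h := Measure.infinitePi_pi (fun _ : ℤ × ℤ => G)
    (s := (Finset.range k).map ⟨_, hinj⟩) (t := fun _ => Set.Ioi M) fun _ _ => measurableSet_Ioi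
  rw [Finset.prod_const, Finset.card_map, Finset.card_range] at h
  rw [← h, envLaw]
  congr 1
  ext t
  simp [Set.pi]

/-- Climb to height `k`, cross there, and come back down. -/
theorem directedTime_one_zero_le (t : ℤ × ℤ → ℝ≥0) (k : ℕ) :
    directedTime t 1 0 ≤ t (0, (k : ℤ)) + 2 * k := by
  have h := directedTime_succ_le t 0 0 k
  have h0 : directedTime t 0 k = k := by simp [directedTime]
  rw [h0] at h
  simp only [Int.cast_zero, zero_sub, abs_neg, Int.cast_natCast, Nat.abs_cast, Nat.cast_zero,
    zero_add] at h
  linarith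

/-- Cross at the lowest height `k ≥ 0` whose edge weighs at most `M`. All lower edges then exceed
`M`, an event of probability `G (Set.Ioi M) ^ k`, which beats the quadratic cost `(M + 2 * k) ^ 2`.
-/
theorem lintegral_directedTime_one_sq_lt_top :
    ∫⁻ t, ENNReal.ofReal (directedTime t 1 0) ^ 2 ∂envLaw G < ∞ := by
  obtain ⟨M, hM⟩ := exists_measure_Ioi_lt_one G
  set A : ℕ → Set (ℤ × ℤ → ℝ≥0) := fun k => {t | ∀ i < k, M < t (0, (i : ℤ))} with hA
  have hAm (k : ℕ) : MeasurableSet (A k) := by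
    simp only [hA, Set.ofPred_forall]
    exact MeasurableSet.iInter fun i => MeasurableSet.iInter fun _ =>
      measurableSet_lt measurable_const (measurable_pi_apply _)
  have hnull : envLaw G (⋂ k, A k) = 0 := by
    refine le_antisymm (ge_of_tendsto' (ENNReal.tendsto_pow_atTop_nhds_zero_of_lt_one hM)
      fun k => ?_) zero_le
    rw [← measure_forall_lt_column G M k]
    exact measure_mono (Set.iInter_subset A k)
  have hle : ∀ᵐ t ∂envLaw G, ENNReal.ofReal (directedTime t 1 0) ^ 2 ≤
      ∑' k : ℕ, (A k).indicator (fun _ => ENNReal.ofReal (((M : ℝ) + 2 * k) ^ 2)) t := by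
    filter_upwards [measure_eq_zero_iff_ae_notMem.1 hnull] with t ht
    have hex : ∃ k : ℕ, t (0, (k : ℤ)) ≤ M := by
      by_contra! h
      exact ht (Set.mem_iInter.2 fun k i _ => h i)
    classical
    have hmem : t ∈ A (Nat.find hex) := fun i hi => not_le.1 (Nat.find_min hex hi)
    refine le_trans ?_ (ENNReal.le_tsum (Nat.find hex))
    rw [Set.indicator_of_mem hmem, ← ENNReal.ofReal_pow (directedTime_nonneg t 1 0)]
    refine ENNReal.ofReal_le_ofReal (pow_le_pow_left₀ (directedTime_nonneg t 1 0) ?_ 2)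
    have h1 := directedTime_one_zero_le t (Nat.find hex)
    have h2 : (t (0, ((Nat.find hex : ℕ) : ℤ)) : ℝ) ≤ M := NNReal.coe_le_coe.2 (Nat.find_spec hex)
    linarith
  refine (lintegral_mono_ae hle).trans_lt ?_
  rw [lintegral_tsum fun k => (measurable_const.indicator (hAm k)).aemeasurable]
  have hq : G (Set.Ioi M) ≠ ∞ := measure_ne_top _ _
  have hterm (k : ℕ) : ∫⁻ t, (A k).indicator
      (fun _ => ENNReal.ofReal (((M : ℝ) + 2 * k) ^ 2)) t ∂envLaw G =
      ENNReal.ofReal (((M : ℝ) + 2 * k) ^ 2 * (G (Set.Ioi M)).toReal ^ k) := by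
    rw [lintegral_indicator_const (hAm k), measure_forall_lt_column, ENNReal.ofReal_mul (sq_nonneg _),
      ENNReal.ofReal_pow ENNReal.toReal_nonneg, ENNReal.ofReal_toReal hq]
  simp_rw [hterm]
  have hsum : Summable fun k : ℕ => ((M : ℝ) + 2 * k) ^ 2 * (G (Set.Ioi M)).toReal ^ k := by
    have hr : ‖(G (Set.Ioi M)).toReal‖ < 1 := by
      rw [Real.norm_of_nonneg ENNReal.toReal_nonneg]
      exact (ENNReal.toReal_lt_toReal hq ENNReal.one_ne_top).2 hM
    have h0 := summable_pow_mul_geometric_of_norm_lt_one 0 hr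
    have h1 := summable_pow_mul_geometric_of_norm_lt_one 1 hr
    have h2 := summable_pow_mul_geometric_of_norm_lt_one 2 hr
    refine (((h0.mul_left ((M : ℝ) ^ 2)).add (h1.mul_left (4 * (M : ℝ)))).add
      (h2.mul_left 4)).congr fun k => ?_
    ring
  rw [← ENNReal.ofReal_tsum_of_nonneg (fun k => by positivity) hsum]
  exact ENNReal.ofReal_lt_top

theorem memLp_directedTime_one : MemLp (fun t => directedTime t 1 0) 2 (envLaw G) := by
  refine ⟨(measurable_directedTime 1 0).aestronglyMeasurable, ?_⟩
  rw [eLpNorm_lt_top_iff_lintegral_rpow_enorm_lt_top (by simp) (by simp)]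
  have h := lintegral_directedTime_one_sq_lt_top G
  simpa [Real.enorm_of_nonneg (directedTime_nonneg _ 1 0)] using h

theorem memLp_directedTime (n : ℕ) (m : ℤ) :
    MemLp (fun t => directedTime t n m) 2 (envLaw G) := by
  have hzero (n : ℕ) : MemLp (fun t => directedTime t n 0) 2 (envLaw G) := by
    induction n with
    | zero => simp [directedTime]
    | succ n ih =>
      refine (ih.add ((memLp_directedTime_one G).comp_measurePreserving
        (measurePreserving_shift G (n, 0)))).mono'
        (measurable_directedTime (n + 1) 0).aestronglyMeasurable (ae_of_all _ fun t => ?_)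
      rw [Real.norm_of_nonneg (directedTime_nonneg _ _ _)]
      simpa using directedTime_add_le t n 1 0 0
  refine ((hzero n).add (memLp_const |(m : ℝ)|)).mono'
    (measurable_directedTime n m).aestronglyMeasurable (ae_of_all _ fun t => ?_)
  rw [Real.norm_of_nonneg (directedTime_nonneg _ _ _)]
  simpa using directedTime_le_add_abs t n m 0

theorem integrable_directedTime (n : ℕ) (m : ℤ) :
    Integrable (fun t => directedTime t n m) (envLaw G) :=
  (memLp_directedTime G n m).integrable (by norm_num)

/-! ### General lemmas on sequences and random variables -/

/-- If second moments `a j` and means `b j` satisfy the recursive bound of a sequence that is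
doubled by adding an independent copy and halved by normalization, the variances are summable. -/
theorem summable_sub_sq_of_halving {a b : ℕ → ℝ} (hb : ∀ j, b j ^ 2 ≤ a j)
    (h : ∀ j, a (j + 1) ≤ a j / 2 + b j ^ 2 / 2) : Summable fun j => a j - b j ^ 2 := by
  -- Each variance is at most half the previous one plus `b j ^ 2 - b (j + 1) ^ 2`. The differences
  -- telescope, so the sum is bounded by half of itself plus `a 0`.
  have key (J : ℕ) : ∑ j ∈ Finset.range (J + 1), (a j - b j ^ 2) ≤
      a 0 - b J ^ 2 + (∑ j ∈ Finset.range J, (a j - b j ^ 2)) / 2 := by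
    induction J with
    | zero => simp
    | succ J ih =>
      rw [Finset.sum_range_succ]
      rw [Finset.sum_range_succ _ J] at ih ⊢
      have := h J
      linarith
  refine summable_of_sum_range_le (c := 2 * a 0) (fun j => sub_nonneg.2 (hb j)) fun J => ?_
  have h1 := key J
  rw [Finset.sum_range_succ] at h1
  have h2 := hb J
  linarith [sq_nonneg (b J)]

/-- The sum of the squared deviations has finite expectation, so it is almost surely finite and its
terms vanish. -/
theorem ae_tendsto_sub_integral_of_summable_variance {Ω : Type*} {_ : MeasurableSpace Ω}
    {μ : Measure Ω} [IsProbabilityMeasure μ] {Y : ℕ → Ω → ℝ} (hY : ∀ j, MemLp (Y j) 2 μ)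
    (h : Summable fun j => variance (Y j) μ) :
    ∀ᵐ ω ∂μ, Tendsto (fun j => Y j ω - ∫ x, Y j x ∂μ) atTop (𝓝 0) := by
  have hmeas (j : ℕ) : AEMeasurable (fun ω => ENNReal.ofReal ((Y j ω - ∫ x, Y j x ∂μ) ^ 2)) μ :=
    (((hY j).aestronglyMeasurable.aemeasurable.sub_const _).pow_const 2).ennreal_ofReal
  have hfin : ∫⁻ ω, ∑' j, ENNReal.ofReal ((Y j ω - ∫ x, Y j x ∂μ) ^ 2) ∂μ ≠ ∞ := by
    rw [lintegral_tsum hmeas]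
    simp_rw [← evariance_eq_lintegral_ofReal, ← ofReal_variance (hY _)]
    rw [← ENNReal.ofReal_tsum_of_nonneg (fun j => variance_nonneg _ _) h]
    exact ENNReal.ofReal_ne_top
  filter_upwards [ae_lt_top' (AEMeasurable.tsum hmeas) hfin] with ω hω
  have h1 := ENNReal.tendsto_cofinite_zero_of_tsum_ne_top hω.ne
  rw [Nat.cofinite_eq_atTop] at h1
  have h2 := (ENNReal.tendsto_toReal ENNReal.zero_ne_top).comp h1
  simp only [Function.comp_def, ENNReal.toReal_ofReal (sq_nonneg _), ENNReal.toReal_zero] at h2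
  have h3 := h2.sqrt
  simp only [Real.sqrt_sq_eq_abs, Real.sqrt_zero] at h3
  exact (tendsto_zero_iff_abs_tendsto_zero _).2 h3

/-- **Scheffé's lemma** for a constant limit. -/
theorem tendsto_eLpNorm_one_sub_const {Ω : Type*} {_ : MeasurableSpace Ω} {μ : Measure Ω}
    [IsProbabilityMeasure μ] {f : ℕ → Ω → ℝ} {c : ℝ} (hf0 : ∀ n ω, 0 ≤ f n ω)
    (hf : ∀ n, Integrable (f n) μ) (hae : ∀ᵐ ω ∂μ, Tendsto (fun n => f n ω) atTop (𝓝 c))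
    (hint : Tendsto (fun n => ∫ ω, f n ω ∂μ) atTop (𝓝 c)) :
    Tendsto (fun n => eLpNorm (fun ω => f n ω - c) 1 μ) atTop (𝓝 0) := by
  have hc : 0 ≤ c := ge_of_tendsto' hint fun n => integral_nonneg (hf0 n)
  -- The negative part of `f n - c` lies between `0` and `c`, so dominated convergence applies; the
  -- `L¹` norm is then recovered from it and the mean.
  have hpos : Tendsto (fun n => ∫ ω, max (c - f n ω) 0 ∂μ) atTop (𝓝 0) := by
    have h := tendsto_integral_of_dominated_convergence (μ := μ)
      (F := fun n ω => max (c - f n ω) 0) (f := fun _ => 0) (fun _ => c)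
      (fun n => (((integrable_const c).sub (hf n)).pos_part).aestronglyMeasurable)
      (integrable_const c) (fun n => ae_of_all _ fun ω => ?_) ?_
    · simpa using h
    · rw [Real.norm_of_nonneg (le_max_right _ _)]
      exact max_le (by linarith [hf0 n ω]) hc
    · filter_upwards [hae] with ω hω
      simpa using (hω.const_sub c).max (tendsto_const_nhds (x := (0 : ℝ)))
  have hnorm (n : ℕ) : eLpNorm (fun ω => f n ω - c) 1 μ =
      ENNReal.ofReal (2 * (∫ ω, max (c - f n ω) 0 ∂μ) + (∫ ω, f n ω ∂μ) - c) := by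
    have hi : Integrable (fun ω => f n ω - c) μ := (hf n).sub (integrable_const c)
    rw [eLpNorm_one_eq_lintegral_enorm, ← ofReal_integral_norm_eq_lintegral_enorm hi]
    congr 1
    have h1 : ∀ ω, ‖f n ω - c‖ = 2 * max (c - f n ω) 0 + (f n ω - c) := fun ω => by
      rw [Real.norm_eq_abs]
      rcases le_total c (f n ω) with h | h
      · rw [abs_of_nonneg (by linarith), max_eq_right (by linarith)]; ring
      · rw [abs_of_nonpos (by linarith), max_eq_left (by linarith)]; ring
    simp_rw [h1]
    have h2 : Integrable (fun ω => 2 * max (c - f n ω) 0) μ :=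
      (((integrable_const c).sub (hf n)).pos_part).const_mul 2
    rw [integral_add h2 hi, integral_const_mul, integral_sub (hf n) (integrable_const c)]
    simp
    ring
  simp_rw [hnorm]
  have h := ENNReal.tendsto_ofReal (((hpos.const_mul 2).add hint).sub_const c)
  simpa using h

theorem tendsto_div_of_monotone_of_tendsto_mul_two_pow {u : ℕ → ℝ} {l : ℝ} (hu : Monotone u)
    (h : ∀ N : ℕ, 0 < N → Tendsto (fun j => u (N * 2 ^ j) / ((N * 2 ^ j : ℕ) : ℝ)) atTop (𝓝 l)) :
    Tendsto (fun n => u n / n) atTop (𝓝 l) := by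
  refine tendsto_div_of_monotone_of_exists_subseq_tendsto_div u l hu fun a ha => ?_
  -- This choice gives `(m + 1) / m ≤ a` for every `m ≥ K`.
  obtain ⟨K, hK⟩ := exists_nat_gt (1 / (a - 1))
  have hK0 : 0 < K := by
    have : 0 < 1 / (a - 1) := by have := sub_pos.2 ha; positivity
    exact_mod_cast this.trans hK
  have hdiv : Tendsto (fun i => i / K) atTop atTop := Nat.tendsto_div_const_atTop hK0.ne'
  -- Floating-point numbers with mantissa in `[K, 2 * K)`: the successor raises the mantissa by one,
  -- and at overflow `2 * K * 2 ^ j = K * 2 ^ (j + 1)`. Only finitely many mantissas occur, so the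
  -- limits along them combine.
  refine ⟨fun i => (K + i % K) * 2 ^ (i / K), Eventually.of_forall fun i => ?_, ?_, ?_⟩
  · have hle : (K + (i + 1) % K) * 2 ^ ((i + 1) / K) ≤ (K + i % K + 1) * 2 ^ (i / K) := by
      have h1 := Nat.div_add_mod' i K
      have h2 := Nat.mod_lt i hK0
      rcases (Nat.succ_le_of_lt h2).lt_or_eq with h3 | h3
      · have h4 : (i + 1) / K = i / K := by
          rw [Nat.div_eq_iff hK0]
          constructor <;> omega
        have h5 : (i + 1) % K = i % K + 1 := by
          have := Nat.div_add_mod' (i + 1) K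
          rw [h4] at this
          omega
        rw [h4, h5, add_assoc]
      · have h6 : i + 1 = K * (i / K + 1) := by
          rw [mul_add, mul_comm K]; omega
        rw [h6, Nat.mul_mod_right, Nat.mul_div_cancel_left _ hK0, pow_succ]
        have : K + i % K + 1 = K * 2 := by omega
        rw [this]
        exact le_of_eq (by ring)
    have hak : (1 : ℝ) ≤ (a - 1) * K := by
      rw [div_lt_iff₀ (sub_pos.2 ha)] at hK
      linarith
    have hKi : (K : ℝ) ≤ (K + i % K : ℕ) := by exact_mod_cast Nat.le_add_right _ _
    have hstep : ((K + i % K : ℕ) : ℝ) + 1 ≤ a * (K + i % K : ℕ) := by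
      nlinarith [sub_pos.2 ha]
    calc (((K + (i + 1) % K) * 2 ^ ((i + 1) / K) : ℕ) : ℝ)
        ≤ (((K + i % K + 1) * 2 ^ (i / K) : ℕ) : ℝ) := by exact_mod_cast hle
      _ = (((K + i % K : ℕ) : ℝ) + 1) * 2 ^ (i / K) := by push_cast; ring
      _ ≤ a * (K + i % K : ℕ) * 2 ^ (i / K) := by gcongr
      _ = a * (((K + i % K) * 2 ^ (i / K) : ℕ) : ℝ) := by push_cast; ring
  · refine tendsto_atTop_mono (fun i => ?_) hdiv
    exact (Nat.lt_two_pow_self).le.trans (Nat.le_mul_of_pos_left _ (by omega))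
  · rw [tendsto_def]
    intro s hs
    have hev : ∀ᶠ j in atTop, ∀ r ∈ Finset.range K,
        u ((K + r) * 2 ^ j) / (((K + r) * 2 ^ j : ℕ) : ℝ) ∈ s :=
      (Filter.eventually_all_finset _).2 fun r _ => (h (K + r) (by omega)) hs
    filter_upwards [hdiv.eventually hev] with i hi
    exact hi (i % K) (Finset.mem_range.2 (Nat.mod_lt i hK0))

theorem tendsto_intCeil_mul_div (v : ℝ) :
    Tendsto (fun n : ℕ => (⌈v * n⌉ : ℝ) / n) atTop (𝓝 v) := by
  have h1 : Tendsto (fun n : ℕ => v + 1 / (n : ℝ)) atTop (𝓝 v) := by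
    simpa using tendsto_one_div_atTop_nhds_zero_nat.const_add v
  refine tendsto_of_tendsto_of_tendsto_of_le_of_le' tendsto_const_nhds h1 ?_ ?_
  · filter_upwards [eventually_gt_atTop 0] with n hn
    rw [le_div_iff₀ (by exact_mod_cast hn)]
    exact Int.le_ceil _
  · filter_upwards [eventually_gt_atTop 0] with n hn
    have hn' : (0 : ℝ) < n := by exact_mod_cast hn
    rw [div_le_iff₀ hn', add_mul, one_div_mul_cancel hn'.ne']
    exact (Int.ceil_lt_add_one _).le

/-! ### The time constant -/

/-- The passage time from the origin to `(n, ⌈v n⌉)`, increased by one to compensate for the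
rounding, so that it is subadditive in `n`. -/
noncomputable def paddedTime (v : ℝ) (n : ℕ) (t : ℤ × ℤ → ℝ≥0) : ℝ :=
  directedTime t n ⌈v * n⌉ + 1

theorem paddedTime_nonneg (v : ℝ) (n : ℕ) (t : ℤ × ℤ → ℝ≥0) : 0 ≤ paddedTime v n t :=
  add_nonneg (directedTime_nonneg t n _) zero_le_one

theorem paddedTime_add_le (v : ℝ) (n k : ℕ) (t : ℤ × ℤ → ℝ≥0) :
    paddedTime v (n + k) t ≤
      paddedTime v n t + paddedTime v k (shift (n, ⌈v * n⌉) t) := by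
  unfold paddedTime
  have h1 := directedTime_add_le t n k ⌈v * n⌉ ⌈v * k⌉
  have h2 := directedTime_le_add_abs t (n + k) ⌈v * (n + k : ℕ)⌉ (⌈v * n⌉ + ⌈v * k⌉)
  have h3 : |((⌈v * (n + k : ℕ)⌉ : ℤ) : ℝ) - ((⌈v * n⌉ + ⌈v * k⌉ : ℤ) : ℝ)| ≤ 1 := by
    have h4 : ⌈v * (n + k : ℕ)⌉ ≤ ⌈v * n⌉ + ⌈v * k⌉ := by
      rw [Nat.cast_add, mul_add]; exact Int.ceil_add_le _ _
    have h5 : ⌈v * n⌉ + ⌈v * k⌉ ≤ ⌈v * (n + k : ℕ)⌉ + 1 := by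
      rw [Nat.cast_add, mul_add]; exact Int.ceil_add_ceil_le _ _
    have h6 : |⌈v * (n + k : ℕ)⌉ - (⌈v * n⌉ + ⌈v * k⌉)| ≤ 1 := abs_le.2 ⟨by omega, by omega⟩
    exact_mod_cast h6
  linarith

theorem memLp_paddedTime (v : ℝ) (n : ℕ) : MemLp (paddedTime v n) 2 (envLaw G) :=
  (memLp_directedTime G n _).add (memLp_const 1)

theorem integrable_paddedTime (v : ℝ) (n : ℕ) : Integrable (paddedTime v n) (envLaw G) :=
  (memLp_paddedTime G v n).integrable (by norm_num)

theorem integral_paddedTime_shift (v : ℝ) (n : ℕ) (a : ℤ × ℤ) :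
    ∫ t, paddedTime v n (shift a t) ∂envLaw G = ∫ t, paddedTime v n t ∂envLaw G := by
  conv_rhs => rw [← (measurePreserving_shift G a).map_eq]
  rw [integral_map (measurable_shift a).aemeasurable]
  rw [(measurePreserving_shift G a).map_eq]
  exact (memLp_paddedTime G v n).aestronglyMeasurable

theorem subadditive_integral_paddedTime (v : ℝ) :
    Subadditive fun n => ∫ t, paddedTime v n t ∂envLaw G := by
  intro n k
  have hk : Integrable (fun t => paddedTime v k (shift (n, ⌈v * n⌉) t)) (envLaw G) :=
    (measurePreserving_shift G (n, ⌈v * n⌉)).integrable_comp_of_integrable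
      (integrable_paddedTime G v k)
  calc ∫ t, paddedTime v (n + k) t ∂envLaw G
      ≤ ∫ t, (paddedTime v n t + paddedTime v k (shift (n, ⌈v * n⌉) t)) ∂envLaw G :=
        integral_mono (integrable_paddedTime G v _) ((integrable_paddedTime G v n).add hk)
          (paddedTime_add_le v n k)
    _ = _ := by
      rw [integral_add (integrable_paddedTime G v n) hk, integral_paddedTime_shift]

/-- The limit of the normalized expected passage time in direction `(1, v)`. -/
noncomputable def timeConstant (v : ℝ) : ℝ := (subadditive_integral_paddedTime G v).lim

theorem tendsto_integral_paddedTime_div (v : ℝ) :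
    Tendsto (fun n : ℕ => (∫ t, paddedTime v n t ∂envLaw G) / n) atTop
      (𝓝 (timeConstant G v)) :=
  (subadditive_integral_paddedTime G v).tendsto_lim
    ⟨0, by
      rintro _ ⟨n, rfl⟩
      exact div_nonneg (integral_nonneg (paddedTime_nonneg v n)) n.cast_nonneg⟩

theorem timeConstant_nonneg (v : ℝ) : 0 ≤ timeConstant G v :=
  ge_of_tendsto' (tendsto_integral_paddedTime_div G v) fun n =>
    div_nonneg (integral_nonneg (paddedTime_nonneg v n)) n.cast_nonneg

theorem integral_paddedTime (v : ℝ) (n : ℕ) :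
    ∫ t, paddedTime v n t ∂envLaw G = (∫ t, directedTime t n ⌈v * n⌉ ∂envLaw G) + 1 := by
  unfold paddedTime
  rw [integral_add (integrable_directedTime G n _) (integrable_const 1)]
  simp

theorem tendsto_integral_directedTime_div (v : ℝ) :
    Tendsto (fun n : ℕ => ∫ t, directedTime t n ⌈v * n⌉ / n ∂envLaw G) atTop
      (𝓝 (timeConstant G v)) := by
  have h := (tendsto_integral_paddedTime_div G v).sub tendsto_one_div_atTop_nhds_zero_nat
  rw [sub_zero] at h
  refine h.congr fun n => ?_
  rw [integral_div, integral_paddedTime]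
  ring

/-- Square the subadditive bound; by independence of the two strips the cross term is the product of
the means, which coincide by stationarity. -/
theorem integral_paddedTime_sq_two_mul_le (v : ℝ) (n : ℕ) :
    ∫ t, paddedTime v (2 * n) t ^ 2 ∂envLaw G ≤
      2 * (∫ t, paddedTime v n t ^ 2 ∂envLaw G) + 2 * (∫ t, paddedTime v n t ∂envLaw G) ^ 2 := by
  set X := paddedTime v n
  set Y := fun t => X (shift (n, ⌈v * n⌉) t)
  have hmp := measurePreserving_shift G (n, ⌈v * n⌉)
  have hX : MemLp X 2 (envLaw G) := memLp_paddedTime G v n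
  have hY : MemLp Y 2 (envLaw G) := hX.comp_measurePreserving hmp
  have hY1 : ∫ t, Y t ∂envLaw G = ∫ t, X t ∂envLaw G := integral_paddedTime_shift G v n _
  have hY2 : ∫ t, Y t ^ 2 ∂envLaw G = ∫ t, X t ^ 2 ∂envLaw G := by
    conv_rhs => rw [← hmp.map_eq]
    rw [integral_map hmp.aemeasurable]
    rw [hmp.map_eq]
    exact hX.integrable_sq.aestronglyMeasurable
  have hXY : IndepFun X Y (envLaw G) :=
    (indepFun_directedTime_shift G n n ⌈v * n⌉ ⌈v * n⌉).comp (measurable_id.add_const 1)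
      (measurable_id.add_const 1)
  have hmul := hXY.integral_fun_mul_eq_mul_integral hX.aestronglyMeasurable
    hY.aestronglyMeasurable
  have hsq : ∀ t, paddedTime v (2 * n) t ^ 2 ≤ (X t ^ 2 + Y t ^ 2) + 2 * (X t * Y t) := fun t => by
    have h := paddedTime_add_le v n n t
    rw [← two_mul] at h
    refine (pow_le_pow_left₀ (paddedTime_nonneg v _ t) h 2).trans_eq ?_
    simp only [X, Y]
    ring
  have hi : Integrable (fun t => X t * Y t) (envLaw G) := hX.integrable_mul hY
  have hs : Integrable (fun t => X t ^ 2 + Y t ^ 2) (envLaw G) :=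
    hX.integrable_sq.add hY.integrable_sq
  calc ∫ t, paddedTime v (2 * n) t ^ 2 ∂envLaw G
      ≤ ∫ t, ((X t ^ 2 + Y t ^ 2) + 2 * (X t * Y t)) ∂envLaw G :=
        integral_mono (memLp_paddedTime G v _).integrable_sq
          (hs.add (hi.const_mul 2)) hsq
    _ = _ := by
      rw [integral_add hs (hi.const_mul 2),
        integral_add hX.integrable_sq hY.integrable_sq, integral_const_mul, hmul, hY1, hY2]
      ring

theorem ae_tendsto_paddedTime_mul_two_pow (v : ℝ) {N : ℕ} (hN : 0 < N) :
    ∀ᵐ t ∂envLaw G, Tendsto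
      (fun j : ℕ => paddedTime v (N * 2 ^ j) t / ((N * 2 ^ j : ℕ) : ℝ)) atTop
      (𝓝 (timeConstant G v)) := by
  set s : ℕ → ℕ := fun j => N * 2 ^ j with hs
  have hs0 (j : ℕ) : (0 : ℝ) < s j := by positivity
  have hs1 (j : ℕ) : s (j + 1) = 2 * s j := by simp only [hs, pow_succ]; ring
  set Y : ℕ → (ℤ × ℤ → ℝ≥0) → ℝ := fun j t => paddedTime v (s j) t / s j with hY
  have hYL (j : ℕ) : MemLp (Y j) 2 (envLaw G) := by
    simpa only [hY, div_eq_inv_mul] using (memLp_paddedTime G v (s j)).const_mul ((s j : ℝ)⁻¹)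
  have hvar (j : ℕ) : variance (Y j) (envLaw G) =
      ∫ t, Y j t ^ 2 ∂envLaw G - (∫ t, Y j t ∂envLaw G) ^ 2 := variance_eq_sub (hYL j)
  have hsum : Summable fun j => variance (Y j) (envLaw G) := by
    simp_rw [hvar]
    refine summable_sub_sq_of_halving (fun j => ?_) fun j => ?_
    · have := variance_nonneg (Y j) (envLaw G)
      rw [hvar] at this
      linarith
    · have h := integral_paddedTime_sq_two_mul_le G v (s j)
      rw [← hs1] at h
      simp only [hY, div_pow, integral_div]
      have h4 : ((s (j + 1) : ℕ) : ℝ) = 2 * s j := by rw [hs1]; push_cast; ring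
      rw [h4, div_le_iff₀ (by have := hs0 j; positivity)]
      refine h.trans_eq ?_
      have := (hs0 j).ne'
      field_simp
  have hmean : Tendsto (fun j => ∫ t, Y j t ∂envLaw G) atTop (𝓝 (timeConstant G v)) := by
    simp only [hY, integral_div]
    refine (tendsto_integral_paddedTime_div G v).comp (tendsto_atTop_mono (fun j => ?_) tendsto_id)
    exact (Nat.lt_two_pow_self).le.trans (Nat.le_mul_of_pos_left _ hN)
  filter_upwards [ae_tendsto_sub_integral_of_summable_variance hYL hsum] with t ht
  refine (show Tendsto (fun j => Y j t) atTop _ from ?_)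
  simpa using ht.add hmean

/-! ### From geometric subsequences to all `n`. -/

/-- The endpoint rises with `n`, so the passage time alone need not be monotone; adding the height
pays for moving the endpoint back down. -/
theorem monotone_directedTime_add_ceil {v : ℝ} (hv : 0 ≤ v) (t : ℤ × ℤ → ℝ≥0) :
    Monotone fun n : ℕ => directedTime t n ⌈v * n⌉ + (⌈v * n⌉ : ℝ) := by
  intro i n hin
  have hc : (⌈v * i⌉ : ℝ) ≤ ⌈v * n⌉ := by
    exact_mod_cast Int.ceil_mono (mul_le_mul_of_nonneg_left (Nat.cast_le.2 hin) hv)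
  have h1 := directedTime_le_add_abs t i ⌈v * i⌉ ⌈v * n⌉
  have h2 : directedTime t i ⌈v * n⌉ ≤ directedTime t n ⌈v * n⌉ := directedTime_mono t _ hin
  rw [abs_of_nonpos (sub_nonpos.2 hc)] at h1
  simp only
  linarith

theorem ae_tendsto_directedTime_div {v : ℝ} (hv : 0 ≤ v) :
    ∀ᵐ t ∂envLaw G, Tendsto (fun n : ℕ => directedTime t n ⌈v * n⌉ / n) atTop
      (𝓝 (timeConstant G v)) := by
  have hall : ∀ᵐ t ∂envLaw G, ∀ N : ℕ, 0 < N → Tendsto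
      (fun j : ℕ => paddedTime v (N * 2 ^ j) t / ((N * 2 ^ j : ℕ) : ℝ)) atTop
      (𝓝 (timeConstant G v)) := by
    rw [ae_all_iff]
    intro N
    by_cases hN : 0 < N
    · filter_upwards [ae_tendsto_paddedTime_mul_two_pow G v hN] with t ht _ using ht
    · exact ae_of_all _ fun t h => absurd h hN
  filter_upwards [hall] with t ht
  have hu := tendsto_div_of_monotone_of_tendsto_mul_two_pow (l := timeConstant G v + v)
    (monotone_directedTime_add_ceil hv t) fun N hN => ?_
  · have h := hu.sub (tendsto_intCeil_mul_div v)
    rw [add_sub_cancel_right] at h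
    exact h.congr fun n => by ring
  · have hsub : Tendsto (fun j : ℕ => N * 2 ^ j) atTop atTop :=
      tendsto_atTop_mono (fun j => (Nat.lt_two_pow_self).le.trans (Nat.le_mul_of_pos_left _ hN))
        tendsto_id
    have h1 := (tendsto_intCeil_mul_div v).comp hsub
    have h2 := (tendsto_one_div_atTop_nhds_zero_nat (𝕜 := ℝ)).comp hsub
    have h3 := ((ht N hN).sub h2).add h1
    rw [sub_zero] at h3
    refine h3.congr fun j => ?_
    simp only [Function.comp_apply, paddedTime]
    ring

/-! ### Convexity -/

/-- Use slope `x` on the first `k` columns and `y` on the remaining `l`. The endpoint is missed by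
at most `|x - y|` from rounding `a * n` to `k`, plus `2` from the ceilings; the extra padding on the
right absorbs one unit. -/
theorem integral_paddedTime_convex_le {x y a b : ℝ} (hab : a + b = 1) {n k l : ℕ}
    (hn : k + l = n) (hk : |a * n - k| ≤ 1) :
    ∫ t, paddedTime (a * x + b * y) n t ∂envLaw G ≤
      (∫ t, paddedTime x k t ∂envLaw G) + (∫ t, paddedTime y l t ∂envLaw G) +
        (|x - y| + 1) := by
  subst hn
  have hl : Integrable (fun t => paddedTime y l (shift (k, ⌈x * k⌉) t)) (envLaw G) :=
    (measurePreserving_shift G (k, ⌈x * k⌉)).integrable_comp_of_integrable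
      (integrable_paddedTime G y l)
  have hkl : Integrable
      (fun t => paddedTime x k t + paddedTime y l (shift (k, ⌈x * k⌉) t)) (envLaw G) :=
    (integrable_paddedTime G x k).add hl
  have hpt : ∀ t, paddedTime (a * x + b * y) (k + l) t ≤
      paddedTime x k t + paddedTime y l (shift (k, ⌈x * k⌉) t) + (|x - y| + 1) := fun t => by
    unfold paddedTime
    have h1 := directedTime_add_le t k l ⌈x * k⌉ ⌈y * l⌉
    have h2 := directedTime_le_add_abs t (k + l) ⌈(a * x + b * y) * (k + l : ℕ)⌉
      (⌈x * k⌉ + ⌈y * l⌉)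
    have h3 : (a * x + b * y) * (k + l : ℕ) - (x * k + y * l) =
        (x - y) * (a * (k + l : ℕ) - k) := by
      obtain rfl : b = 1 - a := by linarith
      push_cast; ring
    have h4 : |(x - y) * (a * (k + l : ℕ) - k)| ≤ |x - y| := by
      rw [abs_mul]
      exact mul_le_of_le_one_right (abs_nonneg _) hk
    rw [← h3] at h4
    have h5 := abs_le.1 h4
    have c1 := Int.le_ceil ((a * x + b * y) * (k + l : ℕ))
    have c2 := Int.ceil_lt_add_one ((a * x + b * y) * (k + l : ℕ))
    have c3 := Int.le_ceil (x * k)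
    have c4 := Int.ceil_lt_add_one (x * k)
    have c5 := Int.le_ceil (y * l)
    have c6 := Int.ceil_lt_add_one (y * l)
    have h6 : |((⌈(a * x + b * y) * (k + l : ℕ)⌉ : ℤ) : ℝ) - ((⌈x * k⌉ + ⌈y * l⌉ : ℤ) : ℝ)| ≤
        |x - y| + 2 := by
      rw [Int.cast_add]
      exact abs_le.2 ⟨by linarith [h5.1], by linarith [h5.2]⟩
    linarith
  calc ∫ t, paddedTime (a * x + b * y) (k + l) t ∂envLaw G
      ≤ ∫ t, (paddedTime x k t + paddedTime y l (shift (k, ⌈x * k⌉) t) + (|x - y| + 1))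
          ∂envLaw G :=
        integral_mono (integrable_paddedTime G _ _) (hkl.add (integrable_const _)) hpt
    _ = _ := by
      rw [integral_add hkl (integrable_const _), integral_add (integrable_paddedTime G x k) hl,
        integral_paddedTime_shift]
      simp

theorem tendsto_integral_paddedTime_comp_div (v : ℝ) {a : ℝ} (ha : 0 < a) {k : ℕ → ℕ}
    (hk : Tendsto (fun n => (k n : ℝ) / n) atTop (𝓝 a)) :
    Tendsto (fun n => (∫ t, paddedTime v (k n) t ∂envLaw G) / n) atTop
      (𝓝 (timeConstant G v * a)) := by
  have hk1 : Tendsto k atTop atTop := by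
    rw [← tendsto_natCast_atTop_iff (R := ℝ)]
    refine (hk.pos_mul_atTop ha (tendsto_natCast_atTop_atTop (R := ℝ))).congr' ?_
    filter_upwards [eventually_gt_atTop 0] with n hn
    exact div_mul_cancel₀ _ (by exact_mod_cast hn.ne')
  refine (((tendsto_integral_paddedTime_div G v).comp hk1).mul hk).congr' ?_
  filter_upwards [hk1.eventually_gt_atTop 0] with n hn
  have : (k n : ℝ) ≠ 0 := by exact_mod_cast hn.ne'
  simp only [Function.comp_apply]
  field_simp

theorem convexOn_timeConstant : ConvexOn ℝ Set.univ (timeConstant G) := by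
  rw [convexOn_iff_forall_pos]
  refine ⟨convex_univ, fun x _ y _ a b ha hb hab => ?_⟩
  simp only [smul_eq_mul]
  have hk : Tendsto (fun n : ℕ => ((⌊a * n⌋₊ : ℕ) : ℝ) / n) atTop (𝓝 a) :=
    (tendsto_nat_floor_mul_div_atTop ha.le).comp (tendsto_natCast_atTop_atTop (R := ℝ))
  have hfl (n : ℕ) : ⌊a * n⌋₊ ≤ n := by
    have : a * n ≤ n := mul_le_of_le_one_left n.cast_nonneg (by linarith)
    exact Nat.floor_le_of_le this
  have hl : Tendsto (fun n : ℕ => ((n - ⌊a * n⌋₊ : ℕ) : ℝ) / n) atTop (𝓝 b) := by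
    have h := hk.const_sub 1
    rw [show 1 - a = b by linarith] at h
    refine h.congr' ?_
    filter_upwards [eventually_gt_atTop 0] with n hn
    rw [Nat.cast_sub (hfl n), sub_div, div_self (by exact_mod_cast hn.ne')]
  have hlim := ((tendsto_integral_paddedTime_comp_div G x ha hk).add
    (tendsto_integral_paddedTime_comp_div G y hb hl)).add
    (tendsto_const_div_atTop_nhds_zero_nat (|x - y| + 1))
  rw [add_zero, mul_comm _ a, mul_comm _ b] at hlim
  refine le_of_tendsto_of_tendsto' (tendsto_integral_paddedTime_div G (a * x + b * y)) hlim
    fun n => ?_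
  rw [← add_div, ← add_div]
  refine div_le_div_of_nonneg_right (integral_paddedTime_convex_le G hab
    (Nat.add_sub_of_le (hfl n)) ?_) n.cast_nonneg
  have h1 := Nat.floor_le (mul_nonneg ha.le (n.cast_nonneg (α := ℝ)))
  have h2 := Nat.lt_floor_add_one (a * (n : ℝ))
  exact abs_le.2 ⟨by linarith, by linarith⟩

end SemiFPP

theorem mainTheorem3 (G : Measure ℝ≥0) [IsProbabilityMeasure G] :
    ∃ Λ : ℝ → ℝ, (∀ v, 0 ≤ v → 0 ≤ Λ v) ∧ ConvexOn ℝ (Set.Ici 0) Λ ∧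
      ∀ (Ω : Type*) [MeasurableSpace Ω] (μ : Measure Ω) [IsProbabilityMeasure μ]
        (τ : ℤ × ℤ → Ω → ℝ≥0),
        (∀ e, Measurable (τ e)) → (∀ e, μ.map (τ e) = G) → iIndepFun τ μ →
        ∀ v : ℝ, 0 ≤ v →
          (∀ᵐ ω ∂μ, Tendsto
            (fun n : ℕ => SemiFPP.passageTime (fun e => τ e ω) (0, 0) (n, ⌈v * n⌉) / n)
            atTop (𝓝 (Λ v))) ∧
          (∀ n : ℕ, Integrable
            (fun ω => SemiFPP.passageTime (fun e => τ e ω) (0, 0) (n, ⌈v * n⌉)) μ) ∧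
          Tendsto
            (fun n : ℕ => eLpNorm
              (fun ω => SemiFPP.passageTime (fun e => τ e ω) (0, 0) (n, ⌈v * n⌉) / n - Λ v) 1 μ)
            atTop (𝓝 0) := by
  refine ⟨SemiFPP.timeConstant G, fun v _ => SemiFPP.timeConstant_nonneg G v,
    (SemiFPP.convexOn_timeConstant G).subset (Set.subset_univ _) (convex_Ici 0), ?_⟩
  intro Ω _ μ _ τ hτ hG hind v hv
  simp_rw [SemiFPP.passageTime_eq_directedTime]
  -- Only the joint law of the weights matters, and independence identifies it with the product law
  -- `envLaw G`.
  have hmp : MeasurePreserving (fun ω e => τ e ω) μ (SemiFPP.envLaw G) :=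
    ⟨measurable_pi_lambda _ hτ, by
      rw [hind.map_fun_eq_infinitePi_map hτ]; simp_rw [hG]; rfl⟩
  have hae : ∀ᵐ ω ∂μ, Tendsto
      (fun n : ℕ => SemiFPP.directedTime (fun e => τ e ω) n ⌈v * n⌉ / n) atTop
      (𝓝 (SemiFPP.timeConstant G v)) :=
    hmp.quasiMeasurePreserving.ae (SemiFPP.ae_tendsto_directedTime_div G hv)
  have hint (n : ℕ) :
      Integrable (fun ω => SemiFPP.directedTime (fun e => τ e ω) n ⌈v * n⌉) μ :=
    hmp.integrable_comp_of_integrable (SemiFPP.integrable_directedTime G n ⌈v * n⌉)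
  refine ⟨hae, hint, SemiFPP.tendsto_eLpNorm_one_sub_const
    (fun n ω => div_nonneg (SemiFPP.directedTime_nonneg _ _ _) n.cast_nonneg)
    (fun n => (hint n).div_const _) hae ?_⟩
  refine (SemiFPP.tendsto_integral_directedTime_div G v).congr fun n => ?_
  rw [← hmp.map_eq, integral_map hmp.aemeasurable]
  exact ((SemiFPP.measurable_directedTime n _).div_const _).aestronglyMeasurable
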